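/- An ultragraph $\mathcal{G}=(G^0,\mathcal{G}^1,r,s)$ consists of countable sets $G^0$ (vertices) and $\mathcal{G}^1$ (edges), a map $s:\mathcal{G}^1\to G^0$ and a map $r:\mathcal{G}^1\to P(G^0)\setminus\{\emptyset\}$. Let $\mathcal{G}^0$ be the smallest collection of subsets of $G^0$ that contains $\{v\}$ for all $v\in G^0$ and $r(e)$ for all $e\in\mathcal{G}^1$ and is closed under finite unions and under non-empty finite intersections (so every member of $\mathcal{G}^0$ is non-empty). Let $W$ be the set of finite sequences $a=a_1\cdots a_n$ of edges, $n\ge 1$, with $s(a_{i+1})\in r(a_i)$ for $1\le i<n$; put $s(a)=s(a_1)$, $r(a)=r(a_n)$. Regard $W$ as a subset of the free group $\mathbb{F}$ on $\mathcal{G}^1$, whose neutral element is denoted $0$. A sink is a vertex $v$ with $s^{-1}(v)=\emptyset$. Let $X$ be the set consisting of the infinite paths $x=x_1x_2\cdots$ ($s(x_{i+1})\in r(x_i)$ for all $i$), with source $s(x)=s(x_1)$; the pairs $(a,v)$ with $a\in W$ and $v\in r(a)$ a sink, with source $s(a)$; and the pairs $(v,v)$ with $v$ a sink, with source $v$. For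 $b\in W$ and $y\in X$ with $s(y)\in r(b)$ let $by\in X$ be the concatenation, where $b(a,v)=(ba,v)$ and $b(v,v)=(b,v)$; put $0y=y$. For $A\in\mathcal{G}^0$ and $b\in W$ let $$X_A=\{x\in X: s(x)\in A\},\qquad X_{bA}=\{by: y\in X,\ s(y)\in r(b)\cap A\}.$$ Let $a,b\in W\cup\{0\}$ be such that $ab^{-1}$ is reduced as written. Let $X_{ab^{-1}}$ be the set of all $ay$ with $y\in X$, where $s(y)\in r(a)$ if $a\ne 0$ and $s(y)\in r(b)$ if $b\neq 0$ (in particular $X_0=X$), and let $\theta_{ab^{-1}}:X_{ba^{-1}}\to X_{ab^{-1}}$ be the bijection $by\mapsto ay$. For all other $c\in\mathbb{F}$ let $X_c=\emptyset$ and let $\theta_c$ be the empty map. Let $R$ be a field. Let $D$ be the (not necessarily unital) $R$-subalgebra of the algebra of all functions $X\to R$ that is generated by the characteristic functions $1_A$ of $X_A$ ($A\in\mathcal{G}^0$), $1_{bA}$ of $X_{bA}$ ($b\in W$, $A\in\mathcal{G}^0$) and $1_c$ of $X_c$ ($c\in\mathbb{F}\setminus\{0\}$). For $t\in\mathbb{F}$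 let $D_t$ be the set of all $R$-linear combinations of non-empty finite products of functions $1_tg$, where $g$ is one of these generators of $D$ and $1_t$ is the characteristic function of $X_t$. For $f\in D_{t^{-1}}$ let $\beta_t(f)$ be the function equal to $f\circ\theta_{t^{-1}}$ on $X_t$ and to $0$ elsewhere. An ideal $I$ of $D$ is $\mathbb{F}$-invariant if $\beta_t(I\cap D_{t^{-1}})\subseteq I$ for all $t\in\mathbb{F}$, and $D$ is $\mathbb{F}$-simple if its only $\mathbb{F}$-invariant ideals are $0$ and $D$. A subcollection $H\subseteq\mathcal{G}^0$ is hereditary if (i) for every $e\in\mathcal{G}^1$, $\{s(e)\}\in H$ implies $r(e)\in H$; (ii) $A\cup B\in H$ for all $A,B\in H$; (iii) $A\in H$, $B\in\mathcal{G}^0$ and $B\subseteq A$ imply $B\in H$. It is saturated if for every $v\in G^0$ with $0<|s^{-1}(v)|<\infty$, $\{r(e): e\in\mathcal{G}^1,\ s(e)=v\}\subseteq H$ implies $\{v\}\in H$. **Theorem.** Let $\mathcal{G}$ be an ultragraph and let $R$ be a field. Then $D$ is $\mathbb{F}$-simple if and only if the only hereditary and saturated subcollections of $\mathcal{G}^0$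 are $\emptyset$ and $\mathcal{G}^0$. -/

import Mathlib

universe u v w

/-- An ultragraph with vertex set `V` and edge set `E`: each edge has a source vertex and a
non-empty set of range vertices. (Countability of `V` and `E` is assumed where it is needed.) -/
structure Ultragraph (V : Type u) (E : Type v) where
  s : E → V
  r : E → Set V
  r_nonempty : ∀ e, (r e).Nonempty

namespace Ultragraph

variable {V : Type u} {E : Type v} (G : Ultragraph V E)

/-- Membership in the collection `𝒢⁰`: the smallest collection of subsets of `V` that contains the
singletons and the ranges of edges and is closed under finite unions and non-empty finite
intersections. -/
inductive MemG0 : Set V → Prop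
  | vertex (v : V) : MemG0 {v}
  | range (e : E) : MemG0 (G.r e)
  | union {A B : Set V} : MemG0 A → MemG0 B → MemG0 (A ∪ B)
  | inter {A B : Set V} : MemG0 A → MemG0 B → (A ∩ B).Nonempty → MemG0 (A ∩ B)

/-- The collection `𝒢⁰`. All its members are non-empty. -/
def G0 : Set (Set V) := {A | G.MemG0 A}

/-- A list of edges that is composable: the source of each edge lies in the range of the preceding
one. The set `W` consists of the non-empty such lists; the empty list plays the role of the neutral
element. -/
def IsPath (a : List E) : Prop := a.IsChain (fun e f => G.s f ∈ G.r e)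

/-- `v` lies in the range of the path `a`, i.e. in the range of its last edge. There is no condition
for the empty list. -/
def InRange (a : List E) (v : V) : Prop := ∀ e ∈ a.getLast?, v ∈ G.r e

/-- `v` is a sink. -/
def IsSink (v : V) : Prop := ∀ e, G.s e ≠ v

/-- The set `X`: infinite paths, together with the pairs `(α, v)` of a finite path `α` and a sink
`v` in its range; the pair `(v, v)` of a sink `v` is `finite [] v`. -/
inductive Boundary (G : Ultragraph V E) : Type (max u v)
  | infinite (p : ℕ → E) (hp : ∀ i, G.s (p (i + 1)) ∈ G.r (p i)) : Boundary G
  | finite (a : List E) (v : V) (ha : G.IsPath a) (hs : G.IsSink v) (hv : G.InRange a v) :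
      Boundary G

theorem InRange.of_drop {a : List E} {v : V} (h : G.InRange a v) (n : ℕ) :
    G.InRange (a.drop n) v := by
  intro e he
  rw [List.getLast?_drop] at he
  split at he
  · simp at he
  · exact h e he

namespace Boundary

variable {G}

/-- The source `s(x)`. -/
def source : Boundary G → V
  | infinite p _ => G.s (p 0)
  | finite [] v _ _ _ => v
  | finite (e :: _) _ _ _ _ => G.s e

/-- Remove the first `n` edges. For `x = (a, v)` with `|a| ≤ n` the result is `(v, v)`. -/
def drop (n : ℕ) : Boundary G → Boundary G
  | infinite p hp => infinite (fun i => p (i + n)) (fun i => by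
      have := hp (i + n); rwa [show i + n + 1 = i + 1 + n by omega] at this)
  | finite a v ha hs hv => finite (a.drop n) v (List.IsChain.drop ha n) hs (hv.of_drop G n)

/-- `x₁ … x_{|a|} = a`; in particular `|x| ≥ |a|`. -/
def HasPrefix (a : List E) : Boundary G → Prop
  | infinite p _ => ∀ i (hi : i < a.length), a[i] = p i
  | finite b _ _ _ _ => a <+: b

theorem isPath_append {a b : List E} (ha : G.IsPath a) (hb : G.IsPath b)
    (h : ∀ f ∈ b.head?, G.InRange a (G.s f)) : G.IsPath (a ++ b) := by
  refine List.isChain_append.2 ⟨ha, hb, fun e he f hf => h f hf e he⟩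

/-- The concatenation `a x` of a path `a` with `x`; defined when `s(x)` is in the range of `a`. -/
def concat (a : List E) : (x : Boundary G) → G.IsPath a → G.InRange a x.source → Boundary G
  | infinite p hp, ha, h => infinite (fun i => if hi : i < a.length then a[i] else p (i - a.length))
      (fun i => by
        rcases lt_trichotomy (i + 1) a.length with h1 | h1 | h1
        · have h2 : i < a.length := by omega
          simp only [h1, h2, dif_pos]
          exact List.isChain_iff_getElem.1 ha i h1
        · have h2 : i < a.length := by omega
          simp only [h1, h2, dif_pos, lt_irrefl, dif_neg, not_false_eq_true, Nat.sub_self]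
          refine h _ ?_
          rw [List.getLast?_eq_getElem?]
          simp [← h1]
        · have h2 : ¬ i < a.length := by omega
          have h3 : ¬ i + 1 < a.length := by omega
          simp only [h3, h2, dif_neg, not_false_eq_true]
          rw [show i + 1 - a.length = i - a.length + 1 by omega]
          exact hp _)
  | finite b v hb hs hv, ha, h => finite (a ++ b) v
      (isPath_append ha hb (by
        intro f hf
        cases b with
        | nil => simp at hf
        | cons e b => simp at hf; subst hf; exact h))
      hs
      (by
        cases b with
        | nil => simpa [source] using h
        | cons e b =>
          intro f hf
          apply hv
          rwa [List.getLast?_append_of_ne_nil _ (by simp)] at hf)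

theorem drop_concat (a : List E) (x : Boundary G) (ha : G.IsPath a) (h : G.InRange a x.source) :
    (concat a x ha h).drop a.length = x := by
  cases x with
  | infinite p hp => simp [concat, drop]
  | finite b v hb hs hv => simp [concat, drop]

theorem hasPrefix_concat (a : List E) (x : Boundary G) (ha : G.IsPath a)
    (h : G.InRange a x.source) : (concat a x ha h).HasPrefix a := by
  cases x with
  | infinite p hp => intro i hi; simp [hi]
  | finite b v hb hs hv => simp [concat, HasPrefix]

theorem HasPrefix.inRange {a : List E} {x : Boundary G} (h : x.HasPrefix a) :
    G.InRange a (x.drop a.length).source := by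
  intro e he
  cases x with
  | infinite p hp =>
    rw [List.getLast?_eq_getElem?] at he
    obtain ⟨hl, rfl⟩ := List.getElem?_eq_some_iff.1 he
    rw [h _ hl]
    have := hp (a.length - 1)
    simpa [drop, source, show a.length - 1 + 1 = a.length by omega] using this
  | finite b v hb hs hv =>
    obtain ⟨c, rfl⟩ := h
    cases c with
    | nil => simpa [drop, source] using hv e (by simpa using he)
    | cons f c =>
      have := (List.isChain_append.1 hb).2.2 e he f (by simp)
      simpa [drop, source] using this

theorem concat_drop {a : List E} {x : Boundary G} (hx : x.HasPrefix a) (ha : G.IsPath a)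
    (h : G.InRange a (x.drop a.length).source) : concat a (x.drop a.length) ha h = x := by
  cases x with
  | infinite p hp =>
    simp only [concat, drop, infinite.injEq]
    funext i
    by_cases hi : i < a.length
    · simp [hi, hx i hi]
    · simp [hi, show i - a.length + a.length = i by omega]
  | finite b v hb hs hv =>
    obtain ⟨c, rfl⟩ := hx
    simp [concat, drop]

end Boundary

/-- The letters of the reduced word of `c` with exponent `1`, in order. -/
noncomputable def pos (c : FreeGroup E) : List E := by
  classical exact (c.toWord.filter (fun l => l.2)).map Prod.fst

/-- The letters of the reduced word of `c` with exponent `-1`, in reverse order. -/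
noncomputable def neg (c : FreeGroup E) : List E := by
  classical exact ((c.toWord.filter (fun l => !l.2)).map Prod.fst).reverse

/-- The reduced form of `c` is `a b⁻¹` for paths `a`, `b` in `W ∪ {0}`; then `a = pos c` and
`b = neg c`. -/
def Admissible (c : FreeGroup E) : Prop := by
  classical exact
    c.toWord = (pos c).map (fun e => (e, true)) ++ (neg c).reverse.map (fun e => (e, false)) ∧
      G.IsPath (pos c) ∧ G.IsPath (neg c)

theorem pos_inv (c : FreeGroup E) : pos c⁻¹ = neg c := by
  classical
  simp [pos, neg, FreeGroup.toWord_inv, FreeGroup.invRev, List.filter_reverse, List.filter_map,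
    Function.comp_def]

theorem neg_inv (c : FreeGroup E) : neg c⁻¹ = pos c := by
  rw [← pos_inv, inv_inv]

theorem Admissible.inv {c : FreeGroup E} (h : G.Admissible c) : G.Admissible c⁻¹ := by
  classical
  refine ⟨?_, by rw [pos_inv]; exact h.2.2, by rw [neg_inv]; exact h.2.1⟩
  rw [FreeGroup.toWord_inv, h.1, pos_inv, neg_inv]
  simp [FreeGroup.invRev, Function.comp_def]

/-- The sets `X_c`, `c ∈ 𝔽`. If `c = a b⁻¹` in reduced form with paths `a`, `b` in `W ∪ {0}`, then
`X_c` is the set of all `x = a y` in `X` with `s(y)` in `r(b)` (no condition when `b = 0`; when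
`a ≠ 0`, `s(y)` is in `r(a)` automatically). For all the other `c` it is empty. -/
def cyl (c : FreeGroup E) : Set (Boundary G) :=
  {x | G.Admissible c ∧ x.HasPrefix (pos c) ∧
    G.InRange (neg c) (x.drop (pos c).length).source}

/-- The set `X_A`. -/
def cylSet (A : Set V) : Set (Boundary G) := {x | x.source ∈ A}

/-- The set `X_{bA}`: all `x = b y` in `X` with `s(y) ∈ A`. -/
def cylPathSet (b : List E) (A : Set V) : Set (Boundary G) :=
  {x | x.HasPrefix b ∧ (x.drop b.length).source ∈ A}

/-- The map `θ_c : X_{c⁻¹} → X_c`; for `c = a b⁻¹` it sends `b y` to `a y`. -/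
noncomputable def thetaFun (c : FreeGroup E) (x : G.cyl c⁻¹) : G.cyl c :=
  have hc : G.Admissible c := by simpa using x.2.1.inv
  have h : G.InRange (pos c) (x.1.drop (neg c).length).source := by
    have := x.2.2.2
    rwa [neg_inv, pos_inv] at this
  ⟨Boundary.concat (pos c) (x.1.drop (neg c).length) hc.2.1 h, hc,
    Boundary.hasPrefix_concat _ _ _ _, by
      rw [Boundary.drop_concat]
      have := x.2.2.1
      rw [pos_inv] at this
      exact this.inRange⟩

/-- The inverse of `θ_c`: for `c = a b⁻¹` it sends `a y` to `b y`. -/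
noncomputable def thetaInv (c : FreeGroup E) (x : G.cyl c) : G.cyl c⁻¹ :=
  ⟨Boundary.concat (neg c) (x.1.drop (pos c).length) x.2.1.2.2 x.2.2.2, x.2.1.inv,
    by rw [pos_inv]; exact Boundary.hasPrefix_concat _ _ _ _, by
      rw [pos_inv, neg_inv, Boundary.drop_concat]
      exact x.2.2.1.inRange⟩

/-- The bijection `θ_c : X_{c⁻¹} → X_c`. -/
noncomputable def theta (c : FreeGroup E) : G.cyl c⁻¹ ≃ G.cyl c where
  toFun := G.thetaFun c
  invFun := G.thetaInv c
  left_inv x := by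
    apply Subtype.ext
    have := x.2.2.1
    rw [pos_inv] at this
    simp only [thetaFun, thetaInv, Boundary.drop_concat]
    exact Boundary.concat_drop this _ _
  right_inv x := by
    apply Subtype.ext
    simp only [thetaFun, thetaInv, Boundary.drop_concat]
    exact Boundary.concat_drop x.2.2.1 _ _

section Algebra

variable (R : Type w) [CommRing R]

/-- The characteristic function of a subset of `X`, with values in `R`. -/
noncomputable def char (S : Set (Boundary G)) : Boundary G → R := S.indicator 1

/-- The characteristic functions `1_A` for `A ∈ 𝒢⁰`, `1_{bA}` for `b ∈ W` and `A ∈ 𝒢⁰`, and `1_c`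
for `c ∈ 𝔽 ∖ {0}`. -/
def generators : Set (Boundary G → R) :=
  {f | (∃ A ∈ G.G0, f = G.char R (G.cylSet A)) ∨
    (∃ b, b ≠ [] ∧ G.IsPath b ∧ ∃ A ∈ G.G0, f = G.char R (G.cylPathSet b A)) ∨
    ∃ c : FreeGroup E, c ≠ 1 ∧ f = G.char R (G.cyl c)}

/-- The (not necessarily unital) `R`-algebra `D` of functions on `X`. -/
noncomputable def D : NonUnitalSubalgebra R (Boundary G → R) :=
  NonUnitalAlgebra.adjoin R (G.generators R)

/-- The ideal `D_t` of `D`: all finite sums of finite products of functions `1_t g` with `g` one of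
the generators of `D`. -/
noncomputable def Dt (t : FreeGroup E) : NonUnitalSubalgebra R (Boundary G → R) :=
  NonUnitalAlgebra.adjoin R ((fun g => G.char R (G.cyl t) * g) '' G.generators R)

variable {R}

open Classical in
/-- `β_c(f) = f ∘ θ_{c⁻¹}` on `X_c`, extended by zero (functions on `X_c` are regarded as functions
on `X` that vanish off `X_c`). Only the values of `f` on `X_{c⁻¹}` matter. -/
noncomputable def beta (c : FreeGroup E) (f : Boundary G → R) : Boundary G → R :=
  fun x => if h : x ∈ G.cyl c then f ((G.theta c).symm ⟨x, h⟩) else 0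

/-- An ideal `I` of `D` is `𝔽`-invariant if `β_t(I ∩ D_{t⁻¹}) ⊆ I` for all `t`. -/
def IsInvariant (I : TwoSidedIdeal (G.D R)) : Prop :=
  ∀ (t : FreeGroup E) (f : G.D R), f ∈ I → (f : Boundary G → R) ∈ G.Dt R t⁻¹ →
    ∃ g ∈ I, (g : Boundary G → R) = G.beta t f

variable (R)

/-- `D` is `𝔽`-simple: its only `𝔽`-invariant ideals are `0` and `D`. -/
def IsFSimple : Prop := ∀ I : TwoSidedIdeal (G.D R), G.IsInvariant I → I = ⊥ ∨ I = ⊤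

end Algebra

/-- Hereditary subcollections of `𝒢⁰`. -/
structure IsHereditary (H : Set (Set V)) : Prop where
  subset : H ⊆ G.G0
  range_mem : ∀ e, {G.s e} ∈ H → G.r e ∈ H
  union_mem : ∀ A ∈ H, ∀ B ∈ H, A ∪ B ∈ H
  mem_of_subset : ∀ A ∈ H, ∀ B ∈ G.G0, B ⊆ A → B ∈ H

/-- Saturated subcollections of `𝒢⁰`. -/
def IsSaturated (H : Set (Set V)) : Prop :=
  ∀ v, {e | G.s e = v}.Nonempty → {e | G.s e = v}.Finite →
    (∀ e, G.s e = v → G.r e ∈ H) → {v} ∈ H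

end Ultragraph

/-! Hereditary saturated collections and invariant ideals determine each other well enough to
transfer triviality. A collection `H` gives the ideal `coveredIdeal` of functions supported in
finitely many sets X_{bB} with B in `H`. An ideal `I` gives the collection `idealCollection` of
those A with 1_A in `I`.

For hereditary `H` the ideal `coveredIdeal` is invariant (`IsCoveredBy.beta`). If it is 0 then `H`
is empty, because it contains 1_A for A in `H`, and X_A is never empty (`exists_source_eq`). If it
is D then each X_A has a finite cover by sets X_{bB} with B in `H`, and saturation, applied along
the paths b by induction on their length, gives A in `H` (`IsSaturated.mem_of_cover`).

Conversely, the collection of an invariant ideal is hereditary and saturated. It is non-empty when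
`I` is non-zero: a function in D is constant on some X_{aA} around any given point
(`exists_cylPathSet_eq`), so dividing by a non-zero value puts 1_{aA} in `I`, and translating by a⁻¹
puts 1_A there. If the collection is all of 𝒢⁰, then `I` is D, since every function in D vanishes
off some X_S whose characteristic function is in `I` (`eq_top_of_idealCollection`). -/

namespace Ultragraph

variable {V : Type u} {E : Type v} {G : Ultragraph V E}

/-! ### Prefixes and sources of points of X -/

namespace Boundary

theorem drop_zero (x : Boundary G) : x.drop 0 = x := by
  cases x <;> rfl

theorem drop_drop (x : Boundary G) (n m : ℕ) : (x.drop n).drop m = x.drop (n + m) := by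
  cases x with
  | infinite p hp => simp [drop, add_comm, add_left_comm]
  | finite a v ha hs hv => simp [drop]

theorem hasPrefix_nil (x : Boundary G) : x.HasPrefix [] := by
  cases x <;> simp [HasPrefix]

theorem hasPrefix_append {x : Boundary G} {a b : List E} :
    x.HasPrefix (a ++ b) ↔ x.HasPrefix a ∧ (x.drop a.length).HasPrefix b := by
  cases x with
  | infinite p hp =>
    simp only [HasPrefix, drop, List.length_append]
    constructor
    · intro h
      refine ⟨fun i hi => ?_, fun i hi => ?_⟩
      · rw [← h i (by omega), List.getElem_append_left]
      · rw [← h (i + a.length) (by omega), List.getElem_append_right (by omega)]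
        simp
    · rintro ⟨h1, h2⟩ i hi
      by_cases hia : i < a.length
      · rw [List.getElem_append_left hia, h1]
      · rw [List.getElem_append_right (by omega), h2]
        congr 1
        omega
  | finite c v ha hs hv =>
    simp only [HasPrefix, drop]
    constructor
    · rintro ⟨d, rfl⟩
      simp
    · rintro ⟨⟨d, rfl⟩, h2⟩
      simpa using h2

theorem HasPrefix.source_eq {x : Boundary G} {e : E} {a : List E} (h : x.HasPrefix (e :: a)) :
    x.source = G.s e := by
  cases x with
  | infinite p hp => exact congrArg G.s (h 0 (by simp)).symm
  | finite c v ha hs hv =>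
    obtain ⟨d, rfl⟩ := h
    rfl

theorem HasPrefix.isPath {x : Boundary G} {a : List E} (h : x.HasPrefix a) : G.IsPath a := by
  cases x with
  | infinite p hp =>
    refine List.isChain_iff_getElem.2 fun i hi => ?_
    rw [h i (by omega), h (i + 1) hi]
    exact hp i
  | finite c v ha hs hv =>
    obtain ⟨d, rfl⟩ := h
    exact (List.isChain_append.1 ha).1

theorem HasPrefix.prefix_or_prefix {x : Boundary G} {a b : List E} (ha : x.HasPrefix a)
    (hb : x.HasPrefix b) : a <+: b ∨ b <+: a := by
  cases x with
  | infinite p hp =>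
    have key : ∀ c d : List E, (infinite p hp : Boundary G).HasPrefix c →
        (infinite p hp : Boundary G).HasPrefix d → c.length ≤ d.length → c <+: d := by
      intro c d hc hd hl
      refine List.prefix_iff_getElem.2 ⟨hl, fun i hi => ?_⟩
      rw [hc i hi, hd i (by omega)]
    rcases le_total a.length b.length with h | h
    · exact Or.inl (key _ _ ha hb h)
    · exact Or.inr (key _ _ hb ha h)
  | finite c v hc hs hv => exact List.prefix_or_prefix_of_prefix ha hb

/-- Every non-sink source is the source of a first edge. -/
theorem exists_hasPrefix_singleton (x : Boundary G) (h : ¬ G.IsSink x.source) :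
    ∃ e, x.HasPrefix [e] := by
  cases x with
  | infinite p hp => exact ⟨p 0, by simp [HasPrefix]⟩
  | finite c v hc hs hv =>
    cases c with
    | nil => exact absurd hs h
    | cons e c => exact ⟨e, by simp [HasPrefix]⟩

/-- If no point of X starts at v, then v is not a sink, and for an edge e leaving v no point starts
at any vertex of r(e) either, as e could be put in front of it. Iterating produces an infinite path
from v, a contradiction. Hence X_A is non-empty for every non-empty A. -/
theorem exists_source_eq (v : V) :
    ∃ x : Boundary G, x.source = v := by
  classical
  by_contra! hv
  have step : ∀ w : {w // ∀ x : Boundary G, x.source ≠ w},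
      ∃ e, G.s e = w.1 ∧ ∃ w' : {w // ∀ x : Boundary G, x.source ≠ w}, w'.1 ∈ G.r e := by
    rintro ⟨w, hw⟩
    have hs : ¬ G.IsSink w := fun hs =>
      hw (finite [] w List.isChain_nil hs (by simp [InRange])) rfl
    simp only [IsSink, not_forall, not_not] at hs
    obtain ⟨e, rfl⟩ := hs
    obtain ⟨u, hu⟩ := G.r_nonempty e
    refine ⟨e, rfl, ⟨u, ?_⟩, hu⟩
    rintro x rfl
    have he : G.InRange [e] x.source := by simpa [InRange] using hu
    exact hw (concat [e] x (List.isChain_singleton e) he) (hasPrefix_concat _ _ _ _).source_eq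
  choose f hf g hg using step
  let q : ℕ → {w // ∀ x : Boundary G, x.source ≠ w} := fun n => g^[n] ⟨v, hv⟩
  refine hv (infinite (fun n => f (q n)) fun i => ?_) (hf _)
  rw [hf, show q (i + 1) = g (q i) from Function.iterate_succ_apply' _ _ _]
  exact hg _

end Boundary

/-! ### Ranges of paths, and the sets X_c in terms of the sets X_{bA} -/

open Boundary

variable (G) in
/-- The range of a path; all of `V` for the empty list. -/
def rangeSet (a : List E) : Set V := {v | G.InRange a v}

theorem rangeSet_mem_G0 {a : List E} (h : a ≠ []) : G.rangeSet a ∈ G.G0 := by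
  have : G.rangeSet a = G.r (a.getLast h) := by
    ext v
    simp [rangeSet, InRange, List.getLast?_eq_getLast_of_ne_nil h]
  rw [this]
  exact MemG0.range _

theorem MemG0.nonempty {A : Set V} (h : G.MemG0 A) : A.Nonempty := by
  induction h with
  | vertex v => exact ⟨v, rfl⟩
  | range e => exact G.r_nonempty e
  | union _ _ h _ => exact h.inl
  | inter _ _ h => exact h

theorem cylPathSet_nil (A : Set V) : G.cylPathSet [] A = G.cylSet A := by
  ext x
  simp [cylPathSet, cylSet, hasPrefix_nil, drop_zero]

/-- The element of the free group given by a path. -/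
def ofPath (a : List E) : FreeGroup E := FreeGroup.mk (a.map fun e => (e, true))

theorem toWord_ofPath [DecidableEq E] (a : List E) :
    (ofPath a).toWord = a.map fun e => (e, true) := by
  rw [ofPath, FreeGroup.toWord_mk]
  refine FreeGroup.IsReduced.reduce_eq ?_
  simp only [FreeGroup.IsReduced, List.isChain_map]
  induction a with
  | nil => simp
  | cons e a ih => cases a <;> simp_all

theorem pos_ofPath (a : List E) : pos (ofPath a) = a := by
  classical
  simp only [pos]
  convert_to List.map Prod.fst (List.filter (fun l => l.2) (ofPath a).toWord) = a
  simp [toWord_ofPath, List.filter_map, Function.comp_def]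

theorem neg_ofPath (a : List E) : neg (ofPath a) = [] := by
  classical
  simp only [neg]
  convert_to (List.map Prod.fst (List.filter (fun l => !l.2) (ofPath a).toWord)).reverse = []
  simp [toWord_ofPath, List.filter_map, Function.comp_def]

theorem admissible_ofPath {a : List E} (h : G.IsPath a) : G.Admissible (ofPath a) := by
  classical
  refine ⟨?_, by rwa [pos_ofPath], by rw [neg_ofPath]; exact List.isChain_nil⟩
  rw [pos_ofPath, neg_ofPath]
  simp [toWord_ofPath]

theorem cyl_ofPath {a : List E} (h : G.IsPath a) :
    G.cyl (ofPath a) = {x | x.HasPrefix a} := by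
  ext x
  simp [cyl, admissible_ofPath h, pos_ofPath, neg_ofPath, InRange]

theorem cyl_ofPath_inv {a : List E} (h : G.IsPath a) :
    G.cyl (ofPath a)⁻¹ = G.cylSet (G.rangeSet a) := by
  ext x
  simp [cyl, (admissible_ofPath h).inv, pos_inv, neg_inv, pos_ofPath, neg_ofPath, hasPrefix_nil,
    drop_zero, cylSet, rangeSet]

theorem cylPathSet_rangeSet (a : List E) :
    G.cylPathSet a (G.rangeSet a) = {x | x.HasPrefix a} := by
  ext x
  exact ⟨fun h => h.1, fun h => ⟨h, h.inRange⟩⟩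

theorem Admissible.eq_one {c : FreeGroup E} (h : G.Admissible c) (h1 : pos c = [])
    (h2 : neg c = []) : c = 1 := by
  classical
  have := h.1
  rw [h1, h2] at this
  exact FreeGroup.toWord_eq_nil_iff.1 (by simpa using this)

theorem cyl_one : G.cyl 1 = Set.univ := by
  have : (1 : FreeGroup E) = ofPath [] := rfl
  rw [this, cyl_ofPath List.isChain_nil]
  ext x
  simp [hasPrefix_nil]

/-- For c = ab⁻¹ the second set is X_{a r(b)} if b ≠ 0, and X_{a r(a)} if b = 0. This lets arguments
about D ignore the generators 1_c. The case c = 1 is excluded because the range of the empty path is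
all of `V`, which need not belong to 𝒢⁰. -/
theorem cyl_eq_cylPathSet {c : FreeGroup E} (hc : c ≠ 1) :
    G.cyl c = ∅ ∨ ∃ b A, G.IsPath b ∧ A ∈ G.G0 ∧ G.cyl c = G.cylPathSet b A := by
  by_cases h : G.Admissible c
  · right
    by_cases hn : neg c = []
    · have hp : pos c ≠ [] := fun hp => hc (h.eq_one hp hn)
      refine ⟨pos c, G.rangeSet (pos c), h.2.1, rangeSet_mem_G0 hp, ?_⟩
      rw [cylPathSet_rangeSet]
      ext x
      simp [cyl, h, hn, InRange]
    · refine ⟨pos c, G.rangeSet (neg c), h.2.1, rangeSet_mem_G0 hn, ?_⟩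
      ext x
      simp [cyl, h, cylPathSet, rangeSet]
  · left
    ext x
    simp [cyl, h]

/-! ### The algebra D, the ideals D_t and the maps β_t -/

section Algebra

variable {R : Type w} [CommRing R]

theorem char_mul_char (S T : Set (Boundary G)) :
    G.char R S * G.char R T = G.char R (S ∩ T) := by
  classical
  ext x
  by_cases hS : x ∈ S <;> by_cases hT : x ∈ T <;> simp [char, hS, hT]

theorem char_union (S T : Set (Boundary G)) :
    G.char R (S ∪ T) = G.char R S + (G.char R T + -(G.char R S * G.char R T)) := by
  classical
  ext x
  by_cases hS : x ∈ S <;> by_cases hT : x ∈ T <;> simp [char, hS, hT]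

theorem char_apply_of_mem {S : Set (Boundary G)} {x : Boundary G} (h : x ∈ S) :
    G.char R S x = 1 := by
  simp [char, h]

theorem char_apply_of_notMem {S : Set (Boundary G)} {x : Boundary G} (h : x ∉ S) :
    G.char R S x = 0 := by
  simp [char, h]

theorem char_empty : G.char R ∅ = 0 :=
  Set.indicator_empty _

theorem mem_of_char_apply_ne_zero {S : Set (Boundary G)} {x : Boundary G}
    (h : G.char R S x ≠ 0) : x ∈ S := by
  by_contra hx
  exact h (char_apply_of_notMem hx)

theorem char_cylPathSet_mem_D {b : List E} {A : Set V} (hb : G.IsPath b) (hA : A ∈ G.G0) :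
    G.char R (G.cylPathSet b A) ∈ G.D R := by
  refine NonUnitalAlgebra.subset_adjoin R ?_
  by_cases h : b = []
  · subst h
    exact Or.inl ⟨A, hA, by rw [cylPathSet_nil]⟩
  · exact Or.inr (Or.inl ⟨b, h, hb, A, hA, rfl⟩)

theorem char_cylSet_mem_D {A : Set V} (hA : A ∈ G.G0) : G.char R (G.cylSet A) ∈ G.D R := by
  rw [← cylPathSet_nil]
  exact char_cylPathSet_mem_D List.isChain_nil hA

theorem char_cyl_mem_D {c : FreeGroup E} (hc : c ≠ 1) : G.char R (G.cyl c) ∈ G.D R :=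
  NonUnitalAlgebra.subset_adjoin R (Or.inr (Or.inr ⟨c, hc, rfl⟩))

theorem char_cyl_mul_mem_D (c : FreeGroup E) {f : Boundary G → R} (hf : f ∈ G.D R) :
    G.char R (G.cyl c) * f ∈ G.D R := by
  -- 1_X is not among the generators, and D need not be unital.
  by_cases hc : c = 1
  · subst hc
    rw [cyl_one]
    convert hf
    ext x
    simp [char]
  · exact mul_mem (char_cyl_mem_D hc) hf

/-- Induction over `D` along the characteristic functions of the sets `X_{bA}`. -/
theorem D_induction {P : (Boundary G → R) → Prop} {f : Boundary G → R} (hf : f ∈ G.D R)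
    (zero : P 0) (char : ∀ b A, G.IsPath b → A ∈ G.G0 → P (G.char R (G.cylPathSet b A)))
    (add : ∀ f g, P f → P g → P (f + g)) (mul : ∀ f g, P f → P g → P (f * g))
    (smul : ∀ (r : R) f, P f → P (r • f)) : P f := by
  induction hf using NonUnitalAlgebra.adjoin_induction with
  | mem f hf =>
    rcases hf with ⟨A, hA, rfl⟩ | ⟨b, -, hb, A, hA, rfl⟩ | ⟨c, hc, rfl⟩
    · rw [← cylPathSet_nil]
      exact char _ _ List.isChain_nil hA
    · exact char _ _ hb hA
    · rcases G.cyl_eq_cylPathSet hc with h | ⟨b, A, hb, hA, h⟩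
      · rw [h, char_empty]
        exact zero
      · rw [h]
        exact char _ _ hb hA
  | add f g _ _ hf hg => exact add f g hf hg
  | zero => exact zero
  | mul f g _ _ hf hg => exact mul f g hf hg
  | smul r f _ hf => exact smul r f hf

theorem char_cyl_mul_mem_Dt (c : FreeGroup E) {f : Boundary G → R} (hf : f ∈ G.D R) :
    G.char R (G.cyl c) * f ∈ G.Dt R c := by
  induction hf using NonUnitalAlgebra.adjoin_induction with
  | mem f hf => exact NonUnitalAlgebra.subset_adjoin R ⟨f, hf, rfl⟩
  | add f g _ _ hf hg =>
    rw [mul_add]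
    exact add_mem hf hg
  | zero =>
    rw [mul_zero]
    exact zero_mem _
  | mul f g _ _ hf hg =>
    have : G.char R (G.cyl c) * (f * g) = G.char R (G.cyl c) * f * (G.char R (G.cyl c) * g) := by
      rw [mul_mul_mul_comm, char_mul_char, Set.inter_self]
    rw [this]
    exact mul_mem hf hg
  | smul r f _ hf =>
    rw [mul_smul_comm]
    exact SMulMemClass.smul_mem r hf

theorem char_mem_Dt {c : FreeGroup E} {S : Set (Boundary G)} (hS : G.char R S ∈ G.D R)
    (h : S ⊆ G.cyl c) : G.char R S ∈ G.Dt R c := by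
  have := char_cyl_mul_mem_Dt c hS
  rwa [char_mul_char, Set.inter_eq_right.2 h] at this

/-- On `X_c`, where `c = a b⁻¹`, the value of `β_c f` at `a y` is `f (b y)`. -/
theorem exists_beta_apply {c : FreeGroup E} {x : Boundary G} (hx : x ∈ G.cyl c) :
    ∃ z : Boundary G, z.HasPrefix (neg c) ∧
      z.drop (neg c).length = x.drop (pos c).length ∧
      ∀ f : Boundary G → R, G.beta c f x = f z := by
  refine ⟨(G.thetaInv c ⟨x, hx⟩).1, hasPrefix_concat _ _ _ _, drop_concat _ _ _ _, fun f => ?_⟩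
  simp only [beta, dif_pos hx]
  rfl

theorem beta_apply_of_notMem {c : FreeGroup E} {x : Boundary G} (hx : x ∉ G.cyl c)
    (f : Boundary G → R) : G.beta c f x = 0 := by
  simp [beta, hx]

theorem beta_add (c : FreeGroup E) (f g : Boundary G → R) :
    G.beta c (f + g) = G.beta c f + G.beta c g := by
  ext x
  by_cases h : x ∈ G.cyl c <;> simp [beta, h]

theorem beta_mul (c : FreeGroup E) (f g : Boundary G → R) :
    G.beta c (f * g) = G.beta c f * G.beta c g := by
  ext x
  by_cases h : x ∈ G.cyl c <;> simp [beta, h]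

theorem beta_smul (c : FreeGroup E) (r : R) (f : Boundary G → R) :
    G.beta c (r • f) = r • G.beta c f := by
  ext x
  by_cases h : x ∈ G.cyl c <;> simp [beta, h]

theorem beta_zero (c : FreeGroup E) : G.beta c (0 : Boundary G → R) = 0 := by
  ext x
  by_cases h : x ∈ G.cyl c <;> simp [beta, h]

/-- `β_c` of a characteristic function, computed from a description of the preimage. -/
theorem beta_char {c : FreeGroup E} {S T : Set (Boundary G)} (hT : T ⊆ G.cyl c)
    (h : ∀ x ∈ G.cyl c, ∀ z : Boundary G, z.HasPrefix (neg c) →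
      z.drop (neg c).length = x.drop (pos c).length → (z ∈ S ↔ x ∈ T)) :
    G.beta c (G.char R S) = G.char R T := by
  ext x
  by_cases hx : x ∈ G.cyl c
  · obtain ⟨z, hz, hd, hf⟩ := exists_beta_apply (R := R) hx
    rw [hf]
    by_cases hxT : x ∈ T
    · rw [char_apply_of_mem hxT, char_apply_of_mem ((h x hx z hz hd).2 hxT)]
    · rw [char_apply_of_notMem hxT, char_apply_of_notMem fun hS => hxT ((h x hx z hz hd).1 hS)]
  · rw [beta_apply_of_notMem hx, char_apply_of_notMem fun h => hx (hT h)]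

/-- Points of X_{c⁻¹} begin with `neg c`, so only its position relative to b matters. If `neg c` is
a prefix of b, it is replaced by `pos c`. If `neg c` properly extends b, the source of its next edge
decides whether X_{bA} contains X_{c⁻¹} or misses it. Otherwise the two sets are disjoint. -/
theorem beta_char_cylPathSet_mem_D (c : FreeGroup E) {b : List E} {A : Set V} (hb : G.IsPath b)
    (hA : A ∈ G.G0) : G.beta c (G.char R (G.cylPathSet b A)) ∈ G.D R := by
  by_cases h1 : neg c <+: b
  · obtain ⟨b', rfl⟩ := h1
    -- If the concatenation is not composable, no point has it as a prefix and the image is empty.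
    by_cases hp : G.IsPath (pos c ++ b')
    · rw [beta_char (T := G.cyl c ∩ G.cylPathSet (pos c ++ b') A) Set.inter_subset_left,
        ← char_mul_char]
      · exact char_cyl_mul_mem_D c (char_cylPathSet_mem_D hp hA)
      · intro x hx z hz hd
        simp only [cylPathSet, Set.mem_ofPred_eq, Set.mem_inter_iff, hx, true_and, hasPrefix_append,
          List.length_append, ← drop_drop, hd, hz, hx.2.1]
    · rw [beta_char (T := ∅) (Set.empty_subset _), char_empty]
      · exact zero_mem _
      · intro x hx z hz hd
        simp only [Set.mem_empty_iff_false, iff_false]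
        intro hzS
        refine hp (HasPrefix.isPath (x := x) (hasPrefix_append.2 ⟨hx.2.1, ?_⟩))
        rw [← hd]
        exact (hasPrefix_append.1 hzS.1).2
  · by_cases h2 : ∃ e d, neg c = b ++ e :: d ∧ G.s e ∈ A
    · obtain ⟨e, d, hn, he⟩ := h2
      rw [beta_char (T := G.cyl c) subset_rfl]
      · refine char_cyl_mem_D ?_
        rintro rfl
        have h0 : neg (1 : FreeGroup E) = [] := neg_ofPath []
        simp [h0] at hn
      · intro x hx z hz hd
        rw [hn] at hz
        have := hasPrefix_append.1 hz
        simp [hx, cylPathSet, this.1, this.2.source_eq, he]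
    · rw [beta_char (T := ∅) (Set.empty_subset _), char_empty]
      · exact zero_mem _
      · intro x hx z hz hd
        simp only [Set.mem_empty_iff_false, iff_false]
        intro hzS
        rcases hz.prefix_or_prefix hzS.1 with h | ⟨d, hd'⟩
        · exact h1 h
        · cases d with
          | nil => exact h1 (by simp [← hd'])
          | cons e d =>
            refine h2 ⟨e, d, hd'.symm, ?_⟩
            rw [← hd'] at hz
            rw [← (hasPrefix_append.1 hz).2.source_eq]
            exact hzS.2

theorem beta_mem_D (c : FreeGroup E) {f : Boundary G → R} (hf : f ∈ G.D R) :
    G.beta c f ∈ G.D R := by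
  refine D_induction (P := fun f => G.beta c f ∈ G.D R) hf ?_ (fun b A hb hA => beta_char_cylPathSet_mem_D c hb hA) ?_ ?_ ?_
  · rw [beta_zero]
    exact zero_mem _
  · intro f g hf hg
    rw [beta_add]
    exact add_mem hf hg
  · intro f g hf hg
    rw [beta_mul]
    exact mul_mem hf hg
  · intro r f hf
    rw [beta_smul]
    exact SMulMemClass.smul_mem r hf

end Algebra

/-! ### Hereditary and saturated collections, and finite covers -/

theorem IsHereditary.rangeSet_mem {H : Set (Set V)} (hH : G.IsHereditary H) {e : E} {d : List E}
    (hp : G.IsPath (e :: d)) (he : {G.s e} ∈ H) : G.rangeSet (e :: d) ∈ H := by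
  induction d generalizing e with
  | nil =>
    have : G.rangeSet [e] = G.r e := by
      ext v
      simp [rangeSet, InRange]
    rw [this]
    exact hH.range_mem e he
  | cons f d ih =>
    have hp' := List.isChain_cons_cons.1 hp
    have : G.rangeSet (e :: f :: d) = G.rangeSet (f :: d) := by
      ext v
      simp [rangeSet, InRange]
    rw [this]
    exact ih hp'.2 (hH.mem_of_subset _ (hH.range_mem e he) _ (MemG0.vertex _)
      (Set.singleton_subset_iff.2 hp'.1))

theorem IsHereditary.mem_of_subset_biUnion {H : Set (Set V)} (hH : G.IsHereditary H)
    (M : List (Set V)) (hM : ∀ B ∈ M, B ∈ H) {A : Set V} (hA : A ∈ G.G0)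
    (hAM : ∀ v ∈ A, ∃ B ∈ M, v ∈ B) : A ∈ H := by
  have key : ∀ M : List (Set V), (∀ B ∈ M, B ∈ H) → M ≠ [] → ∃ U ∈ H, ∀ B ∈ M, B ⊆ U := by
    intro M hM hne
    induction M with
    | nil => exact absurd rfl hne
    | cons B M ih =>
      by_cases h : M = []
      · subst h
        exact ⟨B, hM B (by simp), by simp⟩
      · obtain ⟨U, hU, hUM⟩ := ih (fun C hC => hM C (by simp [hC])) h
        refine ⟨B ∪ U, hH.union_mem _ (hM B (by simp)) _ hU, ?_⟩
        intro C hC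
        rcases List.mem_cons.1 hC with rfl | hC
        · exact Set.subset_union_left
        · exact (hUM C hC).trans Set.subset_union_right
  -- The empty union is not in 𝒢⁰; the non-emptiness of `A` excludes it.
  have hne : M ≠ [] := by
    rintro rfl
    obtain ⟨v, hv⟩ := MemG0.nonempty hA
    simpa using hAM v hv
  obtain ⟨U, hU, hUM⟩ := key M hM hne
  refine hH.mem_of_subset U hU A hA fun v hv => ?_
  obtain ⟨B, hB, hvB⟩ := hAM v hv
  exact hUM B hB hvB

/-- If `X_A` is covered by finitely many sets `X_{bB}` with `B ∈ H`, then `A ∈ H`. -/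
theorem IsSaturated.mem_of_cover {H : Set (Set V)} (hS : G.IsSaturated H) (hH : G.IsHereditary H)
    {A : Set V} (hA : A ∈ G.G0) (L : List (List E × Set V)) (hL : ∀ p ∈ L, p.2 ∈ H)
    (hc : ∀ x ∈ G.cylSet A, ∃ p ∈ L, x ∈ G.cylPathSet p.1 p.2) : A ∈ H := by
  classical
  obtain ⟨n, hn⟩ : ∃ n, ∀ p ∈ L, p.1.length < n := by
    induction L with
    | nil => exact ⟨0, by simp⟩
    | cons p L _ =>
      refine ⟨((p :: L).map fun q => q.1.length).sum + 1, fun q hq => Nat.lt_succ_of_le ?_⟩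
      exact List.single_le_sum (fun _ _ => Nat.zero_le _) _ (List.mem_map_of_mem hq)
  induction n generalizing L A with
  -- Here `L` is empty, yet X_A has a point.
  | zero =>
    obtain ⟨v, hv⟩ := MemG0.nonempty hA
    obtain ⟨x, rfl⟩ := exists_source_eq (G := G) v
    obtain ⟨p, hp, -⟩ := hc x hv
    exact absurd (hn p hp) (Nat.not_lt_zero _)
  | succ n ih =>
    -- Points starting at such a v are covered only through listed paths of positive length. So v
    -- emits an edge, and only finitely many. Removing the first edge e leaves a cover of X_{r(e)}
    -- by shorter paths; by induction r(e) is in `H`, and saturation applies to v.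
    have key : ∀ v ∈ A, (∀ p ∈ L, p.1 = [] → v ∉ p.2) →
        {v} ∈ H ∧ ∃ p ∈ L, ∃ e d, p.1 = e :: d ∧ G.s e = v := by
      intro v hv hvL
      have cov : ∀ x : Boundary G, x.source = v → ∃ e d B, (e :: d, B) ∈ L ∧ G.s e = v ∧
          x ∈ G.cylPathSet (e :: d) B := by
        rintro x rfl
        obtain ⟨⟨b, B⟩, hp, hx⟩ := hc x hv
        cases b with
        | nil =>
          rw [cylPathSet_nil] at hx
          exact absurd hx (hvL _ hp rfl)
        | cons e d => exact ⟨e, d, B, hp, hx.1.source_eq.symm, hx⟩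
      have cov' : ∀ e, G.s e = v → ∀ y : Boundary G, y.source ∈ G.r e →
          ∃ d B, (e :: d, B) ∈ L ∧ y ∈ G.cylPathSet d B := by
        intro e he y hy
        have hr : G.InRange [e] y.source := by simpa [InRange] using hy
        have hpre := hasPrefix_concat [e] y (List.isChain_singleton e) hr
        have hdrop := drop_concat [e] y (List.isChain_singleton e) hr
        obtain ⟨f, d, B, hp, -, hx⟩ := cov _ (hpre.source_eq.trans he)
        have hx1 := hasPrefix_append (a := [f]) (b := d).1 hx.1
        obtain rfl : e = f := by
          rcases hpre.prefix_or_prefix hx1.1 with h | h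
          · simpa using h
          · simpa [eq_comm] using h
        refine ⟨d, B, hp, ?_, ?_⟩
        · rw [← hdrop]
          exact hx1.2
        · rw [← hdrop, drop_drop]
          convert hx.2 using 3
          simp [add_comm]
      obtain ⟨x, hx⟩ := exists_source_eq (G := G) v
      obtain ⟨e, d, B, hp, he, -⟩ := cov x hx
      refine ⟨hS v ⟨e, he⟩ ?_ ?_, _, hp, e, d, rfl, he⟩
      -- Every edge leaving v begins a listed path, since some point of X starts in its range.
      · refine (List.finite_toSet (L.filterMap fun p => p.1.head?)).subset ?_
        intro f hf
        obtain ⟨w, hw⟩ := G.r_nonempty f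
        obtain ⟨y, rfl⟩ := exists_source_eq (G := G) w
        obtain ⟨d, B, hp, -⟩ := cov' f hf y hw
        exact List.mem_filterMap.2 ⟨_, hp, rfl⟩
      · intro f hf
        refine ih (MemG0.range f) ((L.filter fun p => p.1.head? = some f).map
          fun p => (p.1.tail, p.2)) ?_ ?_ ?_
        · simp only [List.mem_map, List.mem_filter]
          rintro _ ⟨p, ⟨hp, -⟩, rfl⟩
          exact hL p hp
        · intro y hy
          obtain ⟨d, B, hp, hy⟩ := cov' f hf y hy
          exact ⟨(d, B), List.mem_map.2 ⟨_, List.mem_filter.2 ⟨hp, by simp⟩, rfl⟩, hy⟩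
        · simp only [List.mem_map, List.mem_filter, decide_eq_true_eq]
          rintro _ ⟨⟨b, B⟩, ⟨hp, hb⟩, rfl⟩
          have := hn _ hp
          cases b with
          | nil => simp at hb
          | cons e d => simpa using this
    -- `A` may be infinite, so a finite family from `H` is needed: the sets paired with the empty
    -- path, and the sources of the first edges of the other paths.
    refine hH.mem_of_subset_biUnion ((L.map fun p => (p.1.head?.elim p.2 fun e => {G.s e})).filter
      (· ∈ H)) (fun B hB => by simpa using (List.mem_filter.1 hB).2) hA fun v hv => ?_
    by_cases h : ∀ p ∈ L, p.1 = [] → v ∉ p.2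
    · obtain ⟨hvH, p, hp, e, d, hed, rfl⟩ := key v hv h
      exact ⟨{G.s e}, List.mem_filter.2 ⟨List.mem_map.2 ⟨p, hp, by simp [hed]⟩, by simpa using hvH⟩,
        rfl⟩
    · push Not at h
      obtain ⟨p, hp, hp0, hvp⟩ := h
      exact ⟨p.2, List.mem_filter.2 ⟨List.mem_map.2 ⟨p, hp, by simp [hp0]⟩,
        by simpa using hL p hp⟩, hvp⟩

/-! ### From a collection to an invariant ideal -/

section Algebra

variable {R : Type w} [CommRing R]

/-- The support of `f` is covered by finitely many sets `X_{bA}` with `A ∈ H`. -/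
def IsCoveredBy (G : Ultragraph V E) (H : Set (Set V)) (f : Boundary G → R) : Prop :=
  ∃ L : List (List E × Set V), (∀ p ∈ L, p.2 ∈ H) ∧
    ∀ x, f x ≠ 0 → ∃ p ∈ L, x ∈ G.cylPathSet p.1 p.2

theorem IsCoveredBy.mono {H : Set (Set V)} {f g : Boundary G → R} (hf : G.IsCoveredBy H f)
    (h : ∀ x, f x = 0 → g x = 0) : G.IsCoveredBy H g := by
  obtain ⟨L, hL, hc⟩ := hf
  exact ⟨L, hL, fun x hx => hc x fun h0 => hx (h x h0)⟩

theorem IsCoveredBy.add {H : Set (Set V)} {f g : Boundary G → R} (hf : G.IsCoveredBy H f)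
    (hg : G.IsCoveredBy H g) : G.IsCoveredBy H (f + g) := by
  obtain ⟨L, hL, hc⟩ := hf
  obtain ⟨M, hM, hd⟩ := hg
  refine ⟨L ++ M, fun p hp => (List.mem_append.1 hp).elim (hL p) (hM p), fun x hx => ?_⟩
  by_cases hfx : f x = 0
  · obtain ⟨p, hp, h⟩ := hd x fun hgx => hx (by simp [hfx, hgx])
    exact ⟨p, List.mem_append_right _ hp, h⟩
  · obtain ⟨p, hp, h⟩ := hc x hfx
    exact ⟨p, List.mem_append_left _ hp, h⟩

theorem IsCoveredBy.beta {H : Set (Set V)} (hH : G.IsHereditary H) {f : Boundary G → R}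
    (hf : G.IsCoveredBy H f) (c : FreeGroup E) : G.IsCoveredBy H (G.beta c f) := by
  classical
  obtain ⟨L, hL, hc⟩ := hf
  -- The second alternative is all of X_c. Its set r(`neg c`) need not be in `H` when X_{bA} misses
  -- X_{c⁻¹}, so the list is filtered afterwards.
  let φ : List E × Set V → List E × Set V := fun p =>
    if neg c <+: p.1 then (pos c ++ p.1.drop (neg c).length, p.2) else (pos c, G.rangeSet (neg c))
  refine ⟨(L.map φ).filter (·.2 ∈ H), fun p hp => by simpa using (List.mem_filter.1 hp).2,
    fun x hx => ?_⟩
  have hxc : x ∈ G.cyl c := by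
    by_contra h
    exact hx (beta_apply_of_notMem h f)
  obtain ⟨z, hz, hd, hb⟩ := exists_beta_apply (R := R) hxc
  rw [hb] at hx
  obtain ⟨⟨b, A⟩, hp, hzA⟩ := hc z hx
  suffices h : (φ (b, A)).2 ∈ H ∧ x ∈ G.cylPathSet (φ (b, A)).1 (φ (b, A)).2 from
    ⟨φ (b, A), List.mem_filter.2 ⟨List.mem_map_of_mem hp, by simpa using h.1⟩, h.2⟩
  by_cases h1 : neg c <+: b
  · simp only [φ, if_pos h1]
    refine ⟨hL _ hp, ?_⟩
    obtain ⟨d, rfl⟩ := h1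
    rw [List.drop_left]
    refine ⟨hasPrefix_append.2 ⟨hxc.2.1, ?_⟩, ?_⟩
    · rw [← hd]
      exact (hasPrefix_append.1 hzA.1).2
    · rw [List.length_append, ← drop_drop, ← hd, drop_drop, ← List.length_append]
      exact hzA.2
  · simp only [φ, if_neg h1]
    -- The path `neg c` properly extends b, and its next edge has its source in A; heredity carries
    -- this singleton along the path to r(`neg c`).
    refine ⟨?_, hxc.2.1, hxc.2.2⟩
    obtain ⟨d, hbd⟩ := (hz.prefix_or_prefix hzA.1).resolve_left h1
    cases d with
    | nil => exact absurd (by simp [← hbd]) h1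
    | cons e d =>
      rw [← hbd] at hz ⊢
      have hz' := (hasPrefix_append.1 hz).2
      have hr : G.rangeSet (b ++ e :: d) = G.rangeSet (e :: d) := by
        ext v
        simp only [rangeSet, InRange, Set.mem_ofPred_eq,
          List.getLast?_append_of_ne_nil b (List.cons_ne_nil e d)]
      rw [hr]
      refine hH.rangeSet_mem hz'.isPath (hH.mem_of_subset A (hL _ hp) _ (MemG0.vertex _) ?_)
      rw [Set.singleton_subset_iff, ← hz'.source_eq]
      exact hzA.2

variable (R) in
/-- The ideal of `D` that belongs to a subcollection of `𝒢⁰`. -/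
noncomputable def coveredIdeal (G : Ultragraph V E) (H : Set (Set V)) : TwoSidedIdeal (G.D R) :=
  TwoSidedIdeal.mk' {f | G.IsCoveredBy H (f : Boundary G → R)}
    ⟨[], by simp, by simp⟩
    (fun hf hg => hf.add hg)
    (fun hf => hf.mono fun x hx => by simp [hx])
    (fun hf => hf.mono fun x hx => by simp [hx])
    (fun hf => hf.mono fun x hx => by simp [hx])

theorem mem_coveredIdeal {H : Set (Set V)} {f : G.D R} :
    f ∈ G.coveredIdeal R H ↔ G.IsCoveredBy H (f : Boundary G → R) :=
  TwoSidedIdeal.mem_mk' _ _ _ _ _ _ _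

theorem isInvariant_coveredIdeal {H : Set (Set V)} (hH : G.IsHereditary H) :
    G.IsInvariant (G.coveredIdeal R H) := fun t f hf _ =>
  ⟨⟨G.beta t f, beta_mem_D t f.2⟩, mem_coveredIdeal.2 ((mem_coveredIdeal.1 hf).beta hH t), rfl⟩

theorem IsFSimple.eq_empty_or_eq_G0 [Nontrivial R] (h : G.IsFSimple R) {H : Set (Set V)}
    (hH : G.IsHereditary H) (hS : G.IsSaturated H) : H = ∅ ∨ H = G.G0 := by
  rcases h _ (isInvariant_coveredIdeal (R := R) hH) with h | h
  · left
    refine Set.eq_empty_of_forall_notMem fun A hA => ?_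
    have hmem : (⟨_, char_cylSet_mem_D (hH.subset hA)⟩ : G.D R) ∈ G.coveredIdeal R H := by
      refine mem_coveredIdeal.2 ⟨[([], A)], by simpa using hA, fun x hx =>
        ⟨_, List.mem_singleton_self _, ?_⟩⟩
      rw [cylPathSet_nil]
      exact mem_of_char_apply_ne_zero hx
    rw [h, TwoSidedIdeal.mem_bot] at hmem
    obtain ⟨v, hv⟩ := MemG0.nonempty (hH.subset hA)
    obtain ⟨x, rfl⟩ := exists_source_eq (G := G) v
    have : G.char R (G.cylSet A) x = 0 := congrFun (congrArg Subtype.val hmem) x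
    rw [char_apply_of_mem (S := G.cylSet A) hv] at this
    exact one_ne_zero this
  · right
    refine hH.subset.antisymm fun A hA => ?_
    have hmem : (⟨_, char_cylSet_mem_D hA⟩ : G.D R) ∈ G.coveredIdeal R H := by
      rw [h]
      trivial
    obtain ⟨L, hL, hc⟩ := mem_coveredIdeal.1 hmem
    exact hS.mem_of_cover hH hA L hL fun x hx => hc x (by simp [char_apply_of_mem hx])

end Algebra

/-! ### From an invariant ideal to a collection -/

section Algebra

variable {R : Type w} [CommRing R]

/-- The functions in an ideal of `D`. -/
def idealFunctions (I : TwoSidedIdeal (G.D R)) : Set (Boundary G → R) :=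
  Subtype.val '' (I : Set (G.D R))

variable {I : TwoSidedIdeal (G.D R)}

theorem idealFunctions_mul_mem {f g : Boundary G → R} (hf : f ∈ idealFunctions I)
    (hg : g ∈ G.D R) : f * g ∈ idealFunctions I := by
  obtain ⟨f, hf, rfl⟩ := hf
  exact ⟨f * ⟨g, hg⟩, I.mul_mem_right _ _ hf, rfl⟩

theorem idealFunctions_char_union_mem {S T : Set (Boundary G)}
    (hS : G.char R S ∈ idealFunctions I) (hT : G.char R T ∈ idealFunctions I) :
    G.char R (S ∪ T) ∈ idealFunctions I := by
  rw [char_union]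
  obtain ⟨f, hf, hf'⟩ := hS
  obtain ⟨g, hg, hg'⟩ := hT
  rw [← hf', ← hg']
  exact ⟨f + (g + -(f * g)), I.add_mem hf (I.add_mem hg (I.neg_mem (I.mul_mem_right _ _ hf))), rfl⟩

theorem idealFunctions_char_subset_mem {S T : Set (Boundary G)}
    (hS : G.char R S ∈ idealFunctions I) (hT : G.char R T ∈ G.D R) (h : T ⊆ S) :
    G.char R T ∈ idealFunctions I := by
  have := idealFunctions_mul_mem hS hT
  rwa [char_mul_char, Set.inter_eq_right.2 h] at this

theorem IsInvariant.beta_char_mem (hI : G.IsInvariant I) {S : Set (Boundary G)}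
    (hS : G.char R S ∈ idealFunctions I) (t : FreeGroup E) (h : S ⊆ G.cyl t⁻¹) :
    G.beta t (G.char R S) ∈ idealFunctions I := by
  obtain ⟨f, hf, hf'⟩ := hS
  rw [← hf']
  obtain ⟨g, hg, hg'⟩ := hI t f hf (by
    rw [hf']
    exact char_mem_Dt (hf' ▸ f.2) h)
  exact ⟨g, hg, hg'⟩

/-- From `1_{aA} ∈ I` to `1_B ∈ I` for `B = A ∩ r(a)`. -/
theorem IsInvariant.char_cylSet_mem (hI : G.IsInvariant I) {a : List E} {A : Set V}
    (ha : G.IsPath a) (h : G.char R (G.cylPathSet a A) ∈ idealFunctions I)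
    (hA : A ⊆ G.rangeSet a) : G.char R (G.cylSet A) ∈ idealFunctions I := by
  have := hI.beta_char_mem h (ofPath a)⁻¹ (by
    rw [inv_inv, cyl_ofPath ha]
    exact fun x hx => hx.1)
  rwa [beta_char (T := G.cylSet A)] at this
  · rw [cyl_ofPath_inv ha]
    exact fun x hx => hA hx
  · intro x hx z hz hd
    rw [neg_inv, pos_ofPath] at hz hd
    rw [pos_inv, neg_ofPath, List.length_nil, drop_zero] at hd
    simp [cylPathSet, hz, hd, cylSet]

/-- From `1_{r(e)} ∈ I` to `1_e ∈ I`. -/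
theorem IsInvariant.char_hasPrefix_singleton_mem (hI : G.IsInvariant I) {e : E}
    (h : G.char R (G.cylSet (G.r e)) ∈ idealFunctions I) :
    G.char R {x : Boundary G | x.HasPrefix [e]} ∈ idealFunctions I := by
  have hp : G.IsPath [e] := List.isChain_singleton e
  have hr : G.rangeSet [e] = G.r e := by
    ext v
    simp [rangeSet, InRange]
  have := hI.beta_char_mem h (ofPath [e]) (by rw [cyl_ofPath_inv hp, hr])
  rwa [beta_char (T := {x : Boundary G | x.HasPrefix [e]})] at this
  · rw [cyl_ofPath hp]
  · intro x hx z hz hd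
    rw [neg_ofPath, List.length_nil, drop_zero, pos_ofPath] at hd
    rw [cyl_ofPath hp] at hx
    refine iff_of_true ?_ hx
    rw [hd, ← hr]
    exact HasPrefix.inRange hx

/-- The subcollection of `𝒢⁰` that belongs to an ideal of `D`. -/
def idealCollection (I : TwoSidedIdeal (G.D R)) : Set (Set V) :=
  {A | A ∈ G.G0 ∧ G.char R (G.cylSet A) ∈ idealFunctions I}

/-- For the edge condition, X_{e r(e)} lies in X_{s(e)}, and translating it by e⁻¹ gives X_{r(e)}.
-/
theorem IsInvariant.isHereditary (hI : G.IsInvariant I) :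
    G.IsHereditary (idealCollection I) where
  subset A hA := hA.1
  range_mem e he := by
    have hp : G.IsPath [e] := List.isChain_singleton e
    refine ⟨MemG0.range e, hI.char_cylSet_mem hp ?_ ?_⟩
    · refine idealFunctions_char_subset_mem he.2 (char_cylPathSet_mem_D hp (MemG0.range e)) ?_
      exact fun x hx => hx.1.source_eq
    · exact fun v hv => by simpa [rangeSet, InRange] using hv
  union_mem A hA B hB := ⟨MemG0.union hA.1 hB.1, idealFunctions_char_union_mem hA.2 hB.2⟩
  mem_of_subset A hA B hB h :=
    ⟨hB, idealFunctions_char_subset_mem hA.2 (char_cylSet_mem_D hB) fun _ hx => h hx⟩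

/-- As v is not a sink, the set of points starting at v is the finite union of the X_e with s(e) =
v, and each 1_e is a translate of 1_{r(e)}. -/
theorem IsInvariant.isSaturated (hI : G.IsInvariant I) :
    G.IsSaturated (idealCollection I) := by
  intro v hne hfin hv
  refine ⟨MemG0.vertex v, ?_⟩
  have key : ∀ F : Set E, F.Finite → F ⊆ {e | G.s e = v} →
      G.char R {x : Boundary G | ∃ e ∈ F, x.HasPrefix [e]} ∈ idealFunctions I := by
    intro F hF
    induction F, hF using Set.Finite.induction_on with
    | empty =>
      intro _
      refine ⟨0, I.zero_mem, ?_⟩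
      simp only [Set.mem_empty_iff_false, false_and, exists_false]
      exact char_empty.symm
    | insert _ _ ih =>
      rename_i e F _ _
      intro h
      have := idealFunctions_char_union_mem
        (hI.char_hasPrefix_singleton_mem (hv e (h (Set.mem_insert e F))).2)
        (ih fun f hf => h (Set.mem_insert_of_mem e hf))
      convert this using 2
      ext x
      simp
  convert key _ hfin subset_rfl using 2
  ext x
  constructor
  · rintro (rfl : x.source = v)
    obtain ⟨e, he⟩ := hne
    obtain ⟨f, hf⟩ := x.exists_hasPrefix_singleton fun hs => hs e he
    exact ⟨f, hf.source_eq.symm, hf⟩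
  · rintro ⟨e, rfl, hx⟩
    exact hx.source_eq

/-- With no unit available, local units are used: each f in D equals 1_S f for some 1_S in `I`. For
X_{bA} with b ≠ 0, the set of points starting at s(b) serves as S. -/
theorem eq_top_of_idealCollection (h : idealCollection I = G.G0) : I = ⊤ := by
  refine top_unique fun f _ => ?_
  have key : ∀ A ∈ G.G0, G.char R (G.cylSet A) ∈ idealFunctions I := by
    intro A hA
    rw [← h] at hA
    exact hA.2
  suffices ∀ f : Boundary G → R, f ∈ G.D R → ∃ S, G.char R S ∈ idealFunctions I ∧
      ∀ x, f x ≠ 0 → x ∈ S by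
    obtain ⟨S, hS, hfS⟩ := this f f.2
    have hmul := idealFunctions_mul_mem hS f.2
    have heq : G.char R S * f.1 = f.1 := by
      ext x
      by_cases hx : f.1 x = 0
      · simp [hx]
      · simp [char_apply_of_mem (hfS x hx)]
    rw [heq] at hmul
    obtain ⟨g, hg, hgf⟩ := hmul
    rwa [← Subtype.ext hgf]
  intro f hf
  refine D_induction (P := fun f => ∃ S, G.char R S ∈ idealFunctions I ∧ ∀ x, f x ≠ 0 → x ∈ S) hf
    ?_ ?_ ?_ ?_ ?_
  · exact ⟨∅, ⟨0, I.zero_mem, char_empty.symm⟩, by simp⟩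
  · intro b A hb hA
    cases b with
    | nil =>
      refine ⟨_, key A hA, fun x hx => ?_⟩
      rw [← cylPathSet_nil]
      exact mem_of_char_apply_ne_zero hx
    | cons e d =>
      exact ⟨_, key _ (MemG0.vertex (G.s e)), fun x hx =>
        (mem_of_char_apply_ne_zero hx).1.source_eq⟩
  · rintro f g ⟨S, hS, hfS⟩ ⟨T, hT, hgT⟩
    refine ⟨S ∪ T, idealFunctions_char_union_mem hS hT, fun x hx => ?_⟩
    by_cases hfx : f x = 0
    · exact Or.inr (hgT x fun hgx => hx (by simp [hfx, hgx]))
    · exact Or.inl (hfS x hfx)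
  · rintro f g ⟨S, hS, hfS⟩ -
    exact ⟨S, hS, fun x hx => hfS x fun h => hx (by simp [h])⟩
  · rintro r f ⟨S, hS, hfS⟩
    exact ⟨S, hS, fun x hx => hfS x fun h => hx (by simp [h])⟩

/-- Every function in `D` is constant on the cylinder of a long initial segment of an infinite
path. -/
theorem exists_forall_hasPrefix_eq {f : Boundary G → R} (hf : f ∈ G.D R) (p : ℕ → E)
    (hp : ∀ i, G.s (p (i + 1)) ∈ G.r (p i)) :
    ∃ N, ∀ n ≥ N, ∀ x : Boundary G, x.HasPrefix ((List.range n).map p) →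
      f x = f (infinite p hp) := by
  refine D_induction (P := fun f => ∃ N, ∀ n ≥ N, ∀ x : Boundary G,
    x.HasPrefix ((List.range n).map p) → f x = f (infinite p hp)) hf ?_ ?_ ?_ ?_ ?_
  · exact ⟨0, by simp⟩
  · intro b A _ _
    -- One edge beyond b is needed: its source decides membership in X_{bA}.
    refine ⟨b.length + 1, fun n hn x hx => ?_⟩
    have hy : (infinite p hp : Boundary G).HasPrefix ((List.range n).map p) := by
      intro i hi
      simp
    have main : ∀ x y : Boundary G, x.HasPrefix ((List.range n).map p) →
        y.HasPrefix ((List.range n).map p) → x ∈ G.cylPathSet b A → y ∈ G.cylPathSet b A := by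
      intro x y hx hy hxA
      obtain ⟨d, hd⟩ : b <+: (List.range n).map p := by
        refine (hxA.1.prefix_or_prefix hx).resolve_right fun h => ?_
        have := h.length_le
        simp at this
        omega
      cases d with
      | nil =>
        have := congrArg List.length hd
        simp at this
        omega
      | cons e d =>
        rw [← hd] at hx hy
        have hx' := hasPrefix_append.1 hx
        have hy' := hasPrefix_append.1 hy
        refine ⟨hy'.1, ?_⟩
        rw [hy'.2.source_eq, ← hx'.2.source_eq]
        exact hxA.2
    by_cases hxA : x ∈ G.cylPathSet b A
    · rw [char_apply_of_mem hxA, char_apply_of_mem (main _ _ hx hy hxA)]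
    · rw [char_apply_of_notMem hxA, char_apply_of_notMem fun h => hxA (main _ _ hy hx h)]
  · rintro f g ⟨N, hN⟩ ⟨M, hM⟩
    exact ⟨max N M, fun n hn x hx => by
      simp [hN n (le_of_max_le_left hn) x hx, hM n (le_of_max_le_right hn) x hx]⟩
  · rintro f g ⟨N, hN⟩ ⟨M, hM⟩
    exact ⟨max N M, fun n hn x hx => by
      simp [hN n (le_of_max_le_left hn) x hx, hM n (le_of_max_le_right hn) x hx]⟩
  · rintro r f ⟨N, hN⟩
    exact ⟨N, fun n hn x hx => by simp [hN n hn x hx]⟩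

/-- Every function in `D` is constant on a set `X_{aA}` around a given point. -/
theorem exists_cylPathSet_eq {f : Boundary G → R} (hf : f ∈ G.D R) (x : Boundary G) :
    ∃ a A, G.IsPath a ∧ A ∈ G.G0 ∧ A ⊆ G.rangeSet a ∧
      ∀ y ∈ G.cylPathSet a A, f y = f x := by
  cases x with
  | infinite p hp =>
    obtain ⟨N, hN⟩ := exists_forall_hasPrefix_eq hf p hp
    -- Length `N + 1` rather than `N` keeps the path non-empty, so that its range is in 𝒢⁰.
    have hpre : (infinite p hp : Boundary G).HasPrefix ((List.range (N + 1)).map p) := by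
      intro i hi
      simp
    exact ⟨_, _, hpre.isPath, rangeSet_mem_G0 (by simp), subset_rfl,
      fun y hy => hN _ (Nat.le_succ N) y hy.1⟩
  | finite a v ha hs hv =>
    -- As v is a sink, this set contains only the point (a, v).
    refine ⟨a, {v}, ha, MemG0.vertex v, Set.singleton_subset_iff.2 hv, ?_⟩
    rintro (⟨p, hp⟩ | ⟨b, w, hb, hw, hbw⟩) ⟨h1, h2⟩
    · exact absurd h2 (hs _)
    · obtain ⟨d, rfl⟩ := h1
      cases d with
      | nil =>
        obtain rfl : w = v := by simpa [drop, source] using h2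
        simp
      | cons e d => exact absurd (by simpa [drop, source] using h2) (hs e)

end Algebra

theorem IsInvariant.idealCollection_nonempty {R : Type w} [Field R] {I : TwoSidedIdeal (G.D R)}
    (hI : G.IsInvariant I) (h : I ≠ ⊥) : (idealCollection I).Nonempty := by
  obtain ⟨f, hf, hf0⟩ : ∃ f ∈ I, f ≠ 0 := by
    by_contra! h0
    exact h (bot_unique fun f hf => (TwoSidedIdeal.mem_bot _).2 (h0 f hf))
  obtain ⟨x, hx⟩ : ∃ x, f.1 x ≠ 0 := by
    by_contra! h0
    exact hf0 (Subtype.ext (funext h0))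
  obtain ⟨a, A, ha, hA, hAa, hc⟩ := exists_cylPathSet_eq f.2 x
  refine ⟨A, hA, hI.char_cylSet_mem ha ?_ hAa⟩
  -- The product is 1_{aA}, as f has the constant value f(x) on X_{aA}; inverting f(x) is where `R`
  -- has to be a field.
  have := idealFunctions_mul_mem ⟨f, hf, rfl⟩
    (SMulMemClass.smul_mem (f.1 x)⁻¹ (char_cylPathSet_mem_D (R := R) ha hA))
  convert this using 1
  ext y
  by_cases hy : y ∈ G.cylPathSet a A
  · simp [char_apply_of_mem hy, hc y hy, hx]
  · simp [char_apply_of_notMem hy]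

end Ultragraph

theorem mainTheorem4 {V : Type u} {E : Type v} [Countable V] [Countable E] (G : Ultragraph V E)
    (R : Type w) [Field R] :
    G.IsFSimple R ↔
      ∀ H : Set (Set V), G.IsHereditary H → G.IsSaturated H → H = ∅ ∨ H = G.G0 := by
  refine ⟨fun h H hH hS => h.eq_empty_or_eq_G0 hH hS, fun h I hI => ?_⟩
  by_cases hbot : I = ⊥
  · exact Or.inl hbot
  · refine Or.inr (Ultragraph.eq_top_of_idealCollection ?_)
    exact (h _ hI.isHereditary hI.isSaturated).resolve_left
      (hI.idealCollection_nonempty hbot).ne_empty
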